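/- Let $k$ be a field and let $k[x]$ be the polynomial Hopf algebra in which $x$ is primitive, i.e. $\Delta(x)=x\otimes 1+1\otimes x$, $\varepsilon(x)=0$. For bialgebras $N,T$ and an associative unital algebra $A$ over $k$ (not assumed commutative), a linear map $\psi\colon N\otimes T\to A$ is a bimeasuring if for all $n,m\in N$ and $t,s\in T$ (in Sweedler notation) $$\psi(nm,t)=\psi(n,t_1)\psi(m,t_2),\quad \psi(1_N,t)=\varepsilon(t)1_A,\quad \psi(n,ts)=\psi(n_1,t)\psi(n_2,s),\quad \psi(n,1_T)=\varepsilon(n)1_A .$$ A universal bimeasuring bialgebra $B(T,A)$ is a bialgebra $B$ together with a bimeasuring $\theta\colon B\otimes T\to A$ such that for every bialgebra $N$ and every bimeasuring $f\colon N\otimes T\to A$ there is a unique bialgebra map $\overline f\colon N\to B$ with $f=\theta(\overline f\otimes 1)$. Then for every $k$-algebra $A$ the universal bimeasuring bialgebra $B(k[x],A)$ exists if and only if $A$ is commutative. Moreover, for every $k$-algebra $A$ and every $\alpha\in A$ there is a bimeasuring $\psi_\alpha\colon k[x]\otimes k[x]\to A$ with $\psi_\alpha(x^i,x^j)=\delta_{ij}\,i!\,\alpha^i$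 for all $i,j\ge 0$; in particular every $\alpha=\psi_\alpha(x,x)$ lies in the image of a bimeasuring. -/

import Mathlib

open scoped TensorProduct Polynomial

universe u v w

/-! ### The polynomial Hopf algebra -/

namespace PolynomialHopf

variable (k : Type u) [CommRing k]

/-- The bialgebra structure on `k[x]` in which `x` is primitive:
`Δ x = x ⊗ 1 + 1 ⊗ x` and `ε x = 0`. -/
noncomputable instance instBialgebra : Bialgebra k k[X] :=
  Bialgebra.ofAlgHom
    (Polynomial.aeval ((Polynomial.X : k[X]) ⊗ₜ[k] (1 : k[X]) + (1 : k[X]) ⊗ₜ[k] Polynomial.X))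
    (Polynomial.aeval (0 : k))
    (by
      ext
      simp [Algebra.TensorProduct.one_def, TensorProduct.add_tmul, TensorProduct.tmul_add]
      abel)
    (by ext; simp)
    (by ext; simp)

theorem comul_X : Coalgebra.comul (R := k) (Polynomial.X : k[X]) =
    Polynomial.X ⊗ₜ[k] 1 + 1 ⊗ₜ[k] Polynomial.X :=
  Polynomial.aeval_X (R := k)
    ((Polynomial.X : k[X]) ⊗ₜ[k] (1 : k[X]) + (1 : k[X]) ⊗ₜ[k] Polynomial.X)

theorem counit_X : Coalgebra.counit (R := k) (Polynomial.X : k[X]) = 0 :=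
  Polynomial.aeval_X (R := k) (0 : k)

/-- The Hopf algebra structure on `k[x]`, with antipode the algebra map `x ↦ -x`. -/
noncomputable instance instHopfAlgebra : HopfAlgebra k k[X] where
  antipode := (Polynomial.aeval (-Polynomial.X : k[X]) : k[X] →ₐ[k] k[X]).toLinearMap
  mul_antipode_rTensor_comul := by
    have h : ((Algebra.TensorProduct.lmul' k (S := k[X])).comp
        ((Algebra.TensorProduct.map (Polynomial.aeval (-Polynomial.X : k[X]))
          (AlgHom.id k k[X])).comp (Bialgebra.comulAlgHom k k[X]))) =
        (Algebra.ofId k k[X]).comp (Bialgebra.counitAlgHom k k[X]) := by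
      ext
      simp [comul_X, counit_X]
    exact congrArg AlgHom.toLinearMap h
  mul_antipode_lTensor_comul := by
    have h : ((Algebra.TensorProduct.lmul' k (S := k[X])).comp
        ((Algebra.TensorProduct.map (AlgHom.id k k[X])
          (Polynomial.aeval (-Polynomial.X : k[X]))).comp (Bialgebra.comulAlgHom k k[X]))) =
        (Algebra.ofId k k[X]).comp (Bialgebra.counitAlgHom k k[X]) := by
      ext
      simp [comul_X, counit_X]
    exact congrArg AlgHom.toLinearMap h

end PolynomialHopf

/-! ### Measurings and bimeasurings -/

/-- A linear map `ψ : C ⊗ B → A` from a coalgebra tensor an algebra to an algebra is a measuring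
if `ψ(c, b b') = ∑ ψ(c₁, b) ψ(c₂, b')` and `ψ(c, 1) = ε(c) 1`. -/
structure IsMeasuring {k C B A : Type*} [CommRing k]
    [AddCommGroup C] [Module k C] [Coalgebra k C]
    [Ring B] [Algebra k B] [Ring A] [Algebra k A]
    (ψ : C ⊗[k] B →ₗ[k] A) : Prop where
  apply_mul : ∀ (c : C) (b b' : B),
    ψ (c ⊗ₜ[k] (b * b')) =
      LinearMap.mul' k A
        (TensorProduct.map ((TensorProduct.curry ψ).flip b) ((TensorProduct.curry ψ).flip b')
          (Coalgebra.comul c))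
  apply_one : ∀ c : C, ψ (c ⊗ₜ[k] (1 : B)) = algebraMap k A (Coalgebra.counit c)

/-- A linear map `ψ : N ⊗ T → A` is a bimeasuring if, through `ψ`, `N` measures `T` to `A` and
`T` measures `N` to `A`. -/
structure IsBimeasuring {k N T A : Type*} [CommRing k]
    [Ring N] [Bialgebra k N] [Ring T] [Bialgebra k T] [Ring A] [Algebra k A]
    (ψ : N ⊗[k] T →ₗ[k] A) : Prop where
  left : IsMeasuring ψ
  right : IsMeasuring (ψ ∘ₗ (TensorProduct.comm k T N).toLinearMap)

/-- A bimeasuring `θ : B ⊗ T → A` is universal if every bimeasuring `f : N ⊗ T → A` is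
`θ ∘ (g ⊗ 1)` for a unique bialgebra map `g : N → B`. -/
structure IsUniversalBimeasuring {k : Type u} {B : Type w} {T A : Type*} [CommRing k]
    [Ring B] [Bialgebra k B] [Ring T] [Bialgebra k T] [Ring A] [Algebra k A]
    (θ : B ⊗[k] T →ₗ[k] A) : Prop where
  isBimeasuring : IsBimeasuring θ
  existsUnique_lift : ∀ (N : Type w) [Ring N] [Bialgebra k N] (f : N ⊗[k] T →ₗ[k] A),
    IsBimeasuring f →
      ∃! g : N →ₐc[k] B, f = θ ∘ₗ LinearMap.rTensor T (g : N →ₗ[k] B)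

/-- The universal bimeasuring bialgebra `B(T, A)` exists (among bialgebras in `Type w`). -/
def HasUniversalBimeasuring (k : Type u) (T : Type u) (A : Type v) [CommRing k]
    [Ring T] [Bialgebra k T] [Ring A] [Algebra k A] : Prop :=
  ∃ (B : Type w) (_ : Ring B) (_ : Bialgebra k B) (θ : B ⊗[k] T →ₗ[k] A),
    IsUniversalBimeasuring θ

/-!
Since `k[x]` is generated as an algebra by `x`, a measuring `N ⊗ k[x] → A` is an algebra map from
`k[x]` to the convolution algebra of linear maps `N → A`, hence an arbitrary linear map
`φ = ψ(-, x) : N → A` (`polynomialMeasuring`, `IsMeasuring.polynomial_ext`). Since `x` is primitive,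
a bimeasuring has `φ(n m) = ε(n) φ(m) + ε(m) φ(n)`; call this a derivation along the counit. If `A`
is commutative, every such `φ` comes from a bimeasuring (`IsCounitDerivation.isBimeasuring`).

*Existence for commutative `A`.* The bialgebra sought represents derivations along the counit into
the vector space `A`. It is the cofree coalgebra `C` on `A`, with the multiplication `C ⊗ C → C`
induced by `c ⊗ d ↦ ε(c) π(d) + ε(d) π(c)`, where `π : C → A` is the universal map; the algebra laws,
and the multiplicativity of the maps into `C` induced by derivations, follow from uniqueness in the
universal property of `C`. With a basis `I` of `A`, the coalgebra `C` is built as the largest space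
of functions `f` on the words in `I` such that `f` is nonzero on finitely many letters only and
`(u, v) ↦ f(u v)` lies in `C ⊗ C`; a linear map `φ : N → A` lifts to `N → C` by sending `n` to the
function `i₁ ⋯ iᵣ ↦ φ_{i₁}(n₁) ⋯ φ_{iᵣ}(nᵣ)`.

*Necessity of commutativity.* Take any `α` and `β` in `A`. Primitive elements of bialgebras that
pair with `x` to `α` and `β` have images `a`, `b` in a universal `B`, and computing `θ(a b, x²)` in
two ways gives `2 α β = α β + β α` (`IsBimeasuring.commute_of_primitive`).

*The bimeasurings `ψ_α`.* The linear coefficient is a scalar-valued derivation along the counit of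
`k[x]`; scaled by `α`, it takes values in the commutative subalgebra generated by `α`, which yields
`ψ_α`. Its values on monomials follow by induction from `ψ_α(p, xʲ⁺¹) = ψ_α(p', xʲ) α`.
-/

open Coalgebra Bialgebra WithConv

/-! ### Measurings of `k[x]` -/

namespace IsMeasuring

section General

variable {k C T A : Type*} [CommRing k] [AddCommGroup C] [Module k C] [Coalgebra k C]
  [Ring T] [Algebra k T] [Ring A] [Algebra k A]

/-- A measuring `C ⊗ T → A`, seen as an algebra map from `T` to the convolution algebra of linear
maps `C → A`. -/
noncomputable def toAlgHom {ψ : C ⊗[k] T →ₗ[k] A} (h : IsMeasuring ψ) :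
    T →ₐ[k] WithConv (C →ₗ[k] A) :=
  AlgHom.ofLinearMap
    ((WithConv.linearEquiv k (C →ₗ[k] A)).symm.toLinearMap ∘ₗ (TensorProduct.curry ψ).flip)
    (by ext c; exact h.apply_one c)
    (fun b b' => by ext c; exact h.apply_mul c b b')

/-- An algebra map from `T` to the convolution algebra of linear maps `C → A` is a measuring
`C ⊗ T → A`. -/
theorem of_algHom (F : T →ₐ[k] WithConv (C →ₗ[k] A)) :
    IsMeasuring (TensorProduct.lift
      ((WithConv.linearEquiv k (C →ₗ[k] A)).toLinearMap ∘ₗ F.toLinearMap).flip) where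
  apply_mul c b b' := LinearMap.congr_fun (congrArg ofConv (map_mul F b b')) c
  apply_one c := LinearMap.congr_fun (congrArg ofConv (map_one F)) c

/-- Precomposing a measuring with a coalgebra map gives a measuring. -/
theorem comp_rTensor {D : Type*} [AddCommGroup D] [Module k D] [Coalgebra k D]
    {ψ : C ⊗[k] T →ₗ[k] A} (h : IsMeasuring ψ) (g : D →ₗc[k] C) :
    IsMeasuring (ψ ∘ₗ LinearMap.rTensor T (g : D →ₗ[k] C)) where
  apply_mul d b b' := by
    have : ∀ b : T, (TensorProduct.curry (ψ ∘ₗ LinearMap.rTensor T (g : D →ₗ[k] C))).flip b =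
      (TensorProduct.curry ψ).flip b ∘ₗ (g : D →ₗ[k] C) := fun b => rfl
    rw [this, this, TensorProduct.map_comp, LinearMap.comp_apply,
      LinearMap.comp_apply, LinearMap.rTensor_tmul, h.apply_mul]
    exact congrArg _ (congrArg _ (CoalgHomClass.map_comp_comul_apply g d).symm)
  apply_one d := by
    rw [LinearMap.comp_apply, LinearMap.rTensor_tmul, h.apply_one]
    exact congrArg _ (CoalgHomClass.counit_comp_apply g d)

/-- Postcomposing a measuring with an algebra map gives a measuring. -/
theorem algHom_comp {A' : Type*} [Ring A'] [Algebra k A'] {ψ : C ⊗[k] T →ₗ[k] A}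
    (h : IsMeasuring ψ) (f : A →ₐ[k] A') : IsMeasuring (f.toLinearMap ∘ₗ ψ) where
  apply_mul c b b' := by
    have : ∀ b : T, (TensorProduct.curry (f.toLinearMap ∘ₗ ψ)).flip b =
      f.toLinearMap ∘ₗ (TensorProduct.curry ψ).flip b := fun b => rfl
    rw [this, this, TensorProduct.map_comp, LinearMap.comp_apply, LinearMap.comp_apply,
      h.apply_mul, ← LinearMap.comp_apply, AlgHom.comp_mul', LinearMap.comp_apply]
  apply_one c := by simp [h.apply_one]

end General

variable {k C A : Type*} [CommRing k] [AddCommGroup C] [Module k C] [Coalgebra k C]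
  [Ring A] [Algebra k A]

/-- A measuring of `k[x]` is determined by its values at `x`, since the corresponding algebra map
is. -/
theorem polynomial_ext {ψ ψ' : C ⊗[k] k[X] →ₗ[k] A} (h : IsMeasuring ψ) (h' : IsMeasuring ψ')
    (hX : ∀ c, ψ (c ⊗ₜ Polynomial.X) = ψ' (c ⊗ₜ Polynomial.X)) : ψ = ψ' := by
  have : h.toAlgHom = h'.toAlgHom :=
    Polynomial.algHom_ext (WithConv.ext (LinearMap.ext hX))
  ext1
  ext1 c
  exact LinearMap.ext fun t => LinearMap.congr_fun (congrArg ofConv (AlgHom.congr_fun this t)) c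

end IsMeasuring

/-- The measuring `C ⊗ k[x] → A` whose value on `c ⊗ x` is `φ c`: its value on `c ⊗ xʲ` is that of
the `j`-th convolution power of `φ`. -/
noncomputable def polynomialMeasuring {k C A : Type*} [CommRing k] [AddCommGroup C] [Module k C]
    [Coalgebra k C] [Ring A] [Algebra k A] (φ : C →ₗ[k] A) : C ⊗[k] k[X] →ₗ[k] A :=
  TensorProduct.lift ((WithConv.linearEquiv k (C →ₗ[k] A)).toLinearMap ∘ₗ
    (Polynomial.aeval (R := k) (toConv φ)).toLinearMap).flip

section PolynomialMeasuring

variable {k C A : Type*} [CommRing k] [AddCommGroup C] [Module k C] [Coalgebra k C]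
  [Ring A] [Algebra k A]

theorem polynomialMeasuring_tmul (φ : C →ₗ[k] A) (c : C) (p : k[X]) :
    polynomialMeasuring φ (c ⊗ₜ p) = Polynomial.aeval (R := k) (toConv φ) p c := rfl

@[simp]
theorem polynomialMeasuring_tmul_X (φ : C →ₗ[k] A) (c : C) :
    polynomialMeasuring φ (c ⊗ₜ Polynomial.X) = φ c := by
  rw [polynomialMeasuring_tmul, Polynomial.aeval_X]

theorem isMeasuring_polynomialMeasuring (φ : C →ₗ[k] A) : IsMeasuring (polynomialMeasuring φ) :=
  .of_algHom (Polynomial.aeval (R := k) (toConv φ))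

end PolynomialMeasuring

/-! ### Derivations along the counit and bimeasurings with `k[x]` -/

/-- A linear map `φ : N → A` on a bialgebra is a derivation along the counit if
`φ (n m) = ε(n) φ(m) + ε(m) φ(n)`. -/
def IsCounitDerivation {k N V : Type*} [CommRing k] [Ring N] [Bialgebra k N] [AddCommGroup V]
    [Module k V] (φ : N →ₗ[k] V) : Prop :=
  ∀ n m : N, φ (n * m) = counit (R := k) n • φ m + counit (R := k) m • φ n

theorem IsCounitDerivation.map_one {k N V : Type*} [CommRing k] [Ring N] [Bialgebra k N]
    [AddCommGroup V] [Module k V] {φ : N →ₗ[k] V} (h : IsCounitDerivation φ) : φ 1 = 0 := by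
  simpa using h 1 1

section ConvTensor

variable {k C D A : Type*} [CommRing k] [AddCommGroup C] [Module k C] [Coalgebra k C]
  [AddCommGroup D] [Module k D] [Coalgebra k D] [CommRing A] [Algebra k A]

/-- For `A` commutative, `(f ⊗ g) ↦ (c ⊗ d ↦ f(c) g(d))` is an algebra map between convolution
algebras. -/
noncomputable def convTensor :
    WithConv (C →ₗ[k] A) ⊗[k] WithConv (D →ₗ[k] A) →ₐ[k] WithConv (C ⊗[k] D →ₗ[k] A) :=
  Algebra.TensorProduct.algHomOfLinearMapTensorProduct
    (TensorProduct.lift (LinearMap.mk₂ k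
      (fun f g => toConv (LinearMap.mul' k A ∘ₗ TensorProduct.map f.ofConv g.ofConv))
      (fun f f' g => by simp [TensorProduct.map_add_left, LinearMap.comp_add])
      (fun c f g => by simp [TensorProduct.map_smul_left, LinearMap.comp_smul])
      (fun f g g' => by simp [TensorProduct.map_add_right, LinearMap.comp_add])
      (fun c f g => by simp [TensorProduct.map_smul_right, LinearMap.comp_smul])))
    (fun f f' g g' => by
      have h := congrArg (fun F => (Algebra.TensorProduct.lmul' k (S := A)).toLinearMap ∘ₗ F.ofConv)
        (TensorProduct.map_convMul_map (f := f) (h := f') (g := g) (k := g'))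
      have h' := LinearMap.algHom_comp_convMul_distrib (Algebra.TensorProduct.lmul' k (S := A))
        (toConv (TensorProduct.map f.ofConv g.ofConv))
        (toConv (TensorProduct.map f'.ofConv g'.ofConv))
      exact WithConv.ext (h.symm.trans h'))
    (by
      ext c d
      simp [Algebra.algebraMap_eq_smul_one, smul_smul, mul_comm])

theorem convTensor_tmul_apply (f : WithConv (C →ₗ[k] A)) (g : WithConv (D →ₗ[k] A)) (c : C)
    (d : D) : convTensor (f ⊗ₜ g) (c ⊗ₜ d) = f c * g d := rfl

end ConvTensor

/-- If `A` is commutative and `φ : N → A` is a derivation along the counit, both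
`t ↦ (n ⊗ m ↦ ψ(n m, t))` and `t ↦ (n ⊗ m ↦ ψ(n, t₁) ψ(m, t₂))` are algebra maps from `k[x]` to the
convolution algebra of linear maps `N ⊗ N → A`, and the derivation property says that they agree on
`x`. -/
theorem IsCounitDerivation.isBimeasuring {k N A : Type*} [CommRing k] [Ring N] [Bialgebra k N]
    [CommRing A] [Algebra k A] {φ : N →ₗ[k] A} (h : IsCounitDerivation φ) :
    IsBimeasuring (polynomialMeasuring φ) where
  left := isMeasuring_polynomialMeasuring φ
  right :=
    { apply_mul := by
        intro t n m
        let a : k[X] →ₐ[k] WithConv (N →ₗ[k] A) := Polynomial.aeval (R := k) (toConv φ)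
        let L := ((isMeasuring_polynomialMeasuring φ).comp_rTensor (mulCoalgHom k N)).toAlgHom
        let R := convTensor.comp ((Algebra.TensorProduct.map a a).comp (comulAlgHom k k[X]))
        -- `L t` is `n ⊗ m ↦ ψ(n m, t)` and `R t` is `n ⊗ m ↦ ψ(n, t₁) ψ(m, t₂)`.
        have hLR : L = R := by
          refine Polynomial.algHom_ext (WithConv.ext (TensorProduct.ext' fun n m => ?_))
          have h1 : L Polynomial.X (n ⊗ₜ m) = φ (n * m) := polynomialMeasuring_tmul_X φ (n * m)
          have h2 : R Polynomial.X =
              convTensor (toConv φ ⊗ₜ 1) + convTensor (1 ⊗ₜ toConv φ) := by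
            simp [R, a, PolynomialHopf.comul_X]
          refine h1.trans ?_
          rw [h2, h, ofConv_add, LinearMap.add_apply, convTensor_tmul_apply, convTensor_tmul_apply]
          simp [Algebra.smul_def, mul_comm, add_comm]
        have key : ∀ s : k[X] ⊗[k] k[X],
            convTensor (Algebra.TensorProduct.map a a s) (n ⊗ₜ m) =
            LinearMap.mul' k A (TensorProduct.map
              ((TensorProduct.curry (polynomialMeasuring φ)) n)
              ((TensorProduct.curry (polynomialMeasuring φ)) m) s) := by
          intro s
          induction s with
          | zero => simp
          | add x y hx hy => simp only [map_add, ofConv_add, LinearMap.add_apply, hx, hy]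
          | tmul x y => rfl
        exact (LinearMap.congr_fun (congrArg ofConv (AlgHom.congr_fun hLR t)) (n ⊗ₜ m)).trans
          (key _)
      apply_one := by
        intro t
        have hE : (Polynomial.aeval (R := k) (toConv φ) t) 1 =
            algebraMap k A (counit (R := k) t) := by
          induction t using Polynomial.induction_on' with
          | add p q hp hq => simp only [map_add, ofConv_add, LinearMap.add_apply, hp, hq]
          | monomial n a =>
            rw [Polynomial.aeval_monomial, ← Algebra.smul_def, ofConv_smul, LinearMap.smul_apply,
              ← Polynomial.C_mul_X_pow_eq_monomial, ← Polynomial.smul_eq_C_mul, map_smul,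
              counit_pow, PolynomialHopf.counit_X, smul_eq_mul, map_mul, Algebra.smul_def]
            cases n with
            | zero => simp
            | succ n => simp [pow_succ, Algebra.TensorProduct.one_def, h.map_one]
        exact hE }

namespace IsBimeasuring

variable {k N A : Type*} [CommRing k] [Ring N] [Bialgebra k N] [Ring A] [Algebra k A]

/-- The linear map `n ↦ f(n, x)` attached to a bimeasuring `f` is a derivation along the counit,
since `x` is primitive. -/
theorem isCounitDerivation {f : N ⊗[k] k[X] →ₗ[k] A} (hf : IsBimeasuring f) :
    IsCounitDerivation ((TensorProduct.curry f).flip Polynomial.X) := by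
  intro n m
  have h := hf.right.apply_mul Polynomial.X n m
  have h1 : ∀ n : N, f (n ⊗ₜ (1 : k[X])) = algebraMap k A (counit n) := hf.left.apply_one
  simp only [PolynomialHopf.comul_X, map_add, TensorProduct.map_tmul, LinearMap.mul'_apply,
    LinearMap.flip_apply, TensorProduct.curry_apply, LinearMap.comp_apply,
    LinearEquiv.coe_coe, TensorProduct.comm_tmul, h1] at h ⊢
  rw [h, Algebra.smul_def, Algebra.smul_def, add_comm, Algebra.commutes (counit (R := k) m)]

theorem algHom_comp {T A' : Type*} [Ring T] [Bialgebra k T] [Ring A'] [Algebra k A']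
    {ψ : N ⊗[k] T →ₗ[k] A}
    (h : IsBimeasuring ψ) (f : A →ₐ[k] A') : IsBimeasuring (f.toLinearMap ∘ₗ ψ) where
  left := h.left.algHom_comp f
  right := h.right.algHom_comp f

/-- A scalar-valued derivation `δ` along the counit gives, for each `α` in a possibly
noncommutative algebra, a bimeasuring with `ψ(n, x) = δ(n) α`: its values lie in the commutative
subalgebra generated by `α`. -/
theorem exists_of_isCounitDerivation {δ : N →ₗ[k] k} (hδ : IsCounitDerivation δ) (α : A) :
    ∃ ψ : N ⊗[k] k[X] →ₗ[k] A, IsBimeasuring ψ ∧ ∀ n, ψ (n ⊗ₜ Polynomial.X) = δ n • α := by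
  have h : IsCounitDerivation (δ.smulRight (Polynomial.X : k[X])) := fun n m => by
    simp [hδ n m, add_smul, mul_smul]
  exact ⟨_, h.isBimeasuring.algHom_comp (Polynomial.aeval α), fun n => by simp⟩

end IsBimeasuring

/-! ### Bimeasurings of `k[x]` with itself -/

namespace PolynomialHopf

variable (k : Type*) [CommRing k]

theorem counit_apply (p : k[X]) : counit (R := k) p = p.coeff 0 := by
  have : (counitAlgHom k k[X]) = Polynomial.aeval (0 : k) :=
    Polynomial.algHom_ext (by simp [counit_X])
  exact (AlgHom.congr_fun this p).trans (Polynomial.coeff_zero_eq_aeval_zero p).symm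

theorem isCounitDerivation_lcoeff : IsCounitDerivation (Polynomial.lcoeff k 1) := fun p q => by
  simp [counit_apply, Polynomial.mul_coeff_one, mul_comm, add_comm]

/-- `(id ⊗ coeff₁) ∘ Δ` is the derivative on `k[x]`, here on the monomials. -/
theorem lTensor_lcoeff_comul_X_pow (i : ℕ) :
    LinearMap.lTensor k[X] (Polynomial.lcoeff k 1) (comul (R := k) (Polynomial.X ^ i : k[X])) =
      (i • (Polynomial.X : k[X]) ^ (i - 1)) ⊗ₜ[k] (1 : k) := by
  have h0 : ∀ s : k[X] ⊗[k] k[X],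
      LinearMap.lTensor k[X] (Polynomial.lcoeff k 1)
        (s * (Polynomial.X ⊗ₜ[k] 1 + 1 ⊗ₜ[k] Polynomial.X)) =
      LinearMap.rTensor k (LinearMap.mulRight k Polynomial.X)
        (LinearMap.lTensor k[X] (Polynomial.lcoeff k 1) s) +
      LinearMap.lTensor k[X] (counit (R := k)) s := by
    intro s
    induction s with
    | zero => simp
    | add x y hx hy => simp only [add_mul, map_add, hx, hy]; abel
    | tmul p q => simp [mul_add, counit_apply]
  induction i with
  | zero => simp [Algebra.TensorProduct.one_def, Polynomial.coeff_one]
  | succ i ih =>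
    rw [pow_succ, comul_mul, comul_X, h0, ih, lTensor_counit_comul, LinearMap.rTensor_tmul,
      ← TensorProduct.add_tmul]
    cases i with
    | zero => simp
    | succ i => simp [pow_succ, add_mul, mul_assoc]

end PolynomialHopf

/-- The values on monomials of a measuring of `k[x]` by `k[x]` for which `ψ(p, x)` is the linear coefficient
of `p` times `α`. -/
theorem IsMeasuring.apply_X_pow_tmul_X_pow {k A : Type*} [CommRing k] [Ring A] [Algebra k A]
    {ψ : k[X] ⊗[k] k[X] →ₗ[k] A} (h : IsMeasuring ψ) {α : A}
    (hX : ∀ p : k[X], ψ (p ⊗ₜ Polynomial.X) = p.coeff 1 • α) (i j : ℕ) :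
    ψ ((Polynomial.X ^ i) ⊗ₜ[k] (Polynomial.X ^ j)) =
      if i = j then (Nat.factorial i : A) * α ^ i else 0 := by
  induction j generalizing i with
  | zero =>
    rw [pow_zero, h.apply_one, PolynomialHopf.counit_apply, Polynomial.coeff_X_pow]
    rcases Nat.eq_zero_or_pos i with rfl | hi
    · simp
    · simp [hi.ne, hi.ne']
  | succ j ih =>
    have key : ∀ s : k[X] ⊗[k] k[X],
        LinearMap.mul' k A (TensorProduct.map ((TensorProduct.curry ψ).flip (Polynomial.X ^ j))
          ((TensorProduct.curry ψ).flip Polynomial.X) s) =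
        LinearMap.mul' k A (TensorProduct.map ((TensorProduct.curry ψ).flip (Polynomial.X ^ j))
          (LinearMap.toSpanSingleton k A α)
          (LinearMap.lTensor k[X] (Polynomial.lcoeff k 1) s)) := by
      intro s
      induction s with
      | zero => simp
      | add x y hx hy => simp only [map_add, hx, hy]
      | tmul p q => simp [hX]
    rw [pow_succ, h.apply_mul, key, PolynomialHopf.lTensor_lcoeff_comul_X_pow,
      TensorProduct.map_tmul, LinearMap.mul'_apply, map_nsmul, LinearMap.flip_apply,
      TensorProduct.curry_apply, ih]
    cases i with
    | zero => simp
    | succ i =>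
      by_cases hij : i = j
      · simp [hij, Nat.factorial_succ, pow_succ, mul_assoc, add_mul]
      · simp [hij]

/-! ### Existence of a universal bimeasuring forces commutativity -/

/-- If primitive elements `a`, `b` of `B` satisfy `θ(a, x) = α` and `θ(b, x) = β`, then `α` and `β`
commute: evaluating `θ(a b, x²)` by the measuring property in the first variable gives
`2 α β`, and by the one in the second variable `α β + β α`. -/
theorem IsBimeasuring.commute_of_primitive {k B A : Type*} [CommRing k] [Ring B] [Bialgebra k B]
    [Ring A] [Algebra k A] {θ : B ⊗[k] k[X] →ₗ[k] A} (h : IsBimeasuring θ) {a b : B}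
    (ha : comul (R := k) a = a ⊗ₜ 1 + 1 ⊗ₜ a) (hb : comul (R := k) b = b ⊗ₜ 1 + 1 ⊗ₜ b)
    (ha0 : counit (R := k) a = 0) (hb0 : counit (R := k) b = 0) :
    Commute (θ (a ⊗ₜ Polynomial.X)) (θ (b ⊗ₜ Polynomial.X)) := by
  have hd := h.isCounitDerivation
  have h1 : θ ((1 : B) ⊗ₜ (Polynomial.X : k[X])) = 0 := hd.map_one
  have hab : θ ((a * b) ⊗ₜ (Polynomial.X : k[X])) = 0 := (hd a b).trans (by simp [ha0, hb0])
  have hε : ∀ n : B, θ (n ⊗ₜ (1 : k[X])) = algebraMap k A (counit n) := h.left.apply_one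
  have hsq : ∀ n : B, comul (R := k) n = n ⊗ₜ 1 + 1 ⊗ₜ n →
      θ (n ⊗ₜ (Polynomial.X * Polynomial.X : k[X])) = 0 := fun n hn => by
    rw [h.left.apply_mul, hn]
    simp [h1]
  have e1 := h.left.apply_mul (a * b) Polynomial.X Polynomial.X
  have e2 := h.right.apply_mul (Polynomial.X * Polynomial.X) a b
  simp only [comul_mul, ha, hb, PolynomialHopf.comul_X, mul_add, add_mul, map_add,
    Algebra.TensorProduct.tmul_mul_tmul, TensorProduct.map_tmul, LinearMap.mul'_apply,
    LinearMap.flip_apply, TensorProduct.curry_apply, LinearMap.comp_apply,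
    LinearEquiv.coe_coe, TensorProduct.comm_tmul, hε, mul_one, one_mul, hab, h1, hsq a ha,
    hsq b hb, zero_mul, mul_zero, zero_add, add_zero] at e1 e2
  exact add_right_cancel (e2.symm.trans e1)

namespace SymmetricAlgebra

variable {k M : Type*} [Field k] [AddCommGroup M] [Module k M]

/-- A linear form on `M` extends to a derivation along the counit on the symmetric algebra of `M`:
the infinitesimal part of the algebra map to the dual numbers it defines. -/
theorem exists_isCounitDerivation (f : M →ₗ[k] k) :
    ∃ δ : SymmetricAlgebra k M →ₗ[k] k, IsCounitDerivation δ ∧ ∀ m, δ (ι k M m) = f m := by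
  let F : SymmetricAlgebra k M →ₐ[k] DualNumber k := lift (TrivSqZeroExt.inrHom k k ∘ₗ f)
  have hF : ∀ n, (F n).fst = counit (R := k) n := by
    have : (TrivSqZeroExt.fstHom k k k).comp F = counitAlgHom k _ := by
      ext m
      simp [F, algebraMapInv_ι]
    exact AlgHom.congr_fun this
  refine ⟨TrivSqZeroExt.sndHom k k ∘ₗ F.toLinearMap, fun n m => ?_, fun m => ?_⟩
  · simp [hF, mul_comm]
  · simp [F]

end SymmetricAlgebra

/-- If a universal bimeasuring bialgebra of `k[x]` and `A` exists, then `A` is commutative. The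
symmetric algebra of a one-dimensional space takes the part of `k[x]` here, to meet the
universe in which the universal property is stated. -/
theorem HasUniversalBimeasuring.mul_comm {k : Type u} [Field k] {A : Type v} [Ring A] [Algebra k A]
    (h : HasUniversalBimeasuring.{u, v, max u w} k k[X] A) (α β : A) : α * β = β * α := by
  obtain ⟨B, _, _, θ, hθ⟩ := h
  let N := SymmetricAlgebra k (ULift.{w} k)
  obtain ⟨δ, hδ, hδ1⟩ := SymmetricAlgebra.exists_isCounitDerivation
    (ULift.moduleEquiv : ULift.{w} k ≃ₗ[k] k).toLinearMap
  let x : N := SymmetricAlgebra.ι k _ (ULift.up 1)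
  have key : ∀ γ : A, ∃ a : B, comul (R := k) a = a ⊗ₜ 1 + 1 ⊗ₜ a ∧ counit (R := k) a = 0 ∧
      θ (a ⊗ₜ Polynomial.X) = γ := by
    intro γ
    obtain ⟨ψ, hψ, hψX⟩ := IsBimeasuring.exists_of_isCounitDerivation hδ γ
    obtain ⟨g, hg, -⟩ := hθ.existsUnique_lift N ψ hψ
    refine ⟨g x, ?_, ?_, ?_⟩
    · rw [← CoalgHomClass.map_comp_comul_apply, SymmetricAlgebra.comul_ι]
      simp [x]
    · rw [CoalgHomClass.counit_comp_apply, SymmetricAlgebra.counit_ι]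
    · have := LinearMap.congr_fun hg (x ⊗ₜ Polynomial.X)
      rw [hψX, hδ1] at this
      simpa using this.symm
  obtain ⟨a, ha, ha0, rfl⟩ := key α
  obtain ⟨b, hb, hb0, rfl⟩ := key β
  exact hθ.isBimeasuring.commute_of_primitive ha hb ha0 hb0

/-! ### Cofree coalgebras -/

/-- If a family of linear forms separates the points of `X` and another one those of `Y`, the
products of their members separate the points of `X ⊗ Y`. -/
theorem TensorProduct.eq_zero_of_separating {k X Y ι κ : Type*} [Field k] [AddCommGroup X]
    [Module k X] [AddCommGroup Y] [Module k Y] {e : ι → X →ₗ[k] k} {e' : κ → Y →ₗ[k] k}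
    (he : ∀ x, (∀ i, e i x = 0) → x = 0) (he' : ∀ y, (∀ j, e' j y = 0) → y = 0) {t : X ⊗[k] Y}
    (ht : ∀ i j, LinearMap.mul' k k (TensorProduct.map (e i) (e' j) t) = 0) : t = 0 := by
  classical
  let b := Module.Basis.ofVectorSpace k X
  have h1 : ∀ i j (s : X ⊗[k] Y), LinearMap.mul' k k (TensorProduct.map (e i) (e' j) s) =
      e i (TensorProduct.rid k X (LinearMap.lTensor X (e' j) s)) := by
    intro i j s
    induction s with
    | zero => simp
    | add x y hx hy => simp only [map_add, hx, hy]
    | tmul x y => simp [mul_comm]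
  have h2 : ∀ i j (s : X ⊗[k] Y), e' j (TensorProduct.equivFinsuppOfBasisLeft b s i) =
      b.repr (TensorProduct.rid k X (LinearMap.lTensor X (e' j) s)) i := by
    intro i j s
    induction s with
    | zero => simp
    | add x y hx hy => simp only [map_add, Finsupp.add_apply, hx, hy]
    | tmul x y => simp [mul_comm]
  rw [← (TensorProduct.equivFinsuppOfBasisLeft b).map_eq_zero_iff]
  ext i
  refine he' _ fun j => ?_
  rw [h2, he _ fun i => (h1 i j t).symm.trans (ht i j)]
  simp

section Admissible

variable {k I : Type*} [Field k]

/-- The product of the evaluations at `u` and at `v`, on `W ⊗ W` for a space `W` of functions on the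
words in `I`. -/
noncomputable def evalPair (W : Submodule k (FreeMonoid I → k)) (u v : FreeMonoid I) :
    W ⊗[k] W →ₗ[k] k :=
  LinearMap.mul' k k ∘ₗ TensorProduct.map (LinearMap.proj u ∘ₗ W.subtype)
    (LinearMap.proj v ∘ₗ W.subtype)

/-- A space `W` of functions on words is admissible if each `f ∈ W` is nonzero on finitely many
letters only and `(u, v) ↦ f (u v)` is given by an element of `W ⊗ W`. -/
def IsAdmissible (W : Submodule k (FreeMonoid I → k)) : Prop :=
  ∀ f ∈ W, {i | f (FreeMonoid.of i) ≠ 0}.Finite ∧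
    ∃ t : W ⊗[k] W, ∀ u v, evalPair W u v t = f (u * v)

variable (k I)

/-- The sum of all admissible spaces of functions on words; it is itself admissible, hence the
largest one. -/
def cofreeSubmodule : Submodule k (FreeMonoid I → k) :=
  sSup {W | IsAdmissible W}

theorem isAdmissible_cofreeSubmodule : IsAdmissible (cofreeSubmodule k I) := by
  intro f hf
  rw [cofreeSubmodule, sSup_eq_iSup'] at hf
  refine Submodule.iSup_induction _ (motive := fun f => {i | f (FreeMonoid.of i) ≠ 0}.Finite ∧
    ∃ t : cofreeSubmodule k I ⊗[k] cofreeSubmodule k I, ∀ u v,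
      evalPair (cofreeSubmodule k I) u v t = f (u * v)) hf ?_ ?_ ?_
  · intro W f hf
    obtain ⟨h1, t, ht⟩ := W.2 f hf
    have hW : W.1 ≤ cofreeSubmodule k I := le_sSup W.2
    refine ⟨h1, TensorProduct.map (Submodule.inclusion hW) (Submodule.inclusion hW) t,
      fun u v => ?_⟩
    rw [← ht, evalPair, LinearMap.comp_apply, TensorProduct.map_map]
    rfl
  · exact ⟨by simp, 0, by simp⟩
  · rintro f g ⟨hf, s, hs⟩ ⟨hg, t, ht⟩
    refine ⟨(hf.union hg).subset fun i hi => ?_, s + t, fun u v => by simp [hs, ht]⟩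
    by_contra h
    simp only [Set.mem_union, Set.mem_ofPred_eq, not_or, not_not] at h
    exact hi (by simp [h.1, h.2])

/-- The cofree coalgebra on the vector space with basis `I`, realised inside the functions on the
words in `I`. -/
def CofreeCoalgebra : Type _ := cofreeSubmodule k I

end Admissible

namespace CofreeCoalgebra

section Coalgebra

variable {k I : Type*} [Field k]

noncomputable instance instAddCommGroup : AddCommGroup (CofreeCoalgebra k I) :=
  inferInstanceAs (AddCommGroup (cofreeSubmodule k I))

noncomputable instance : Module k (CofreeCoalgebra k I) :=
  inferInstanceAs (Module k (cofreeSubmodule k I))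

/-- Evaluation at a word. -/
noncomputable def eval (w : FreeMonoid I) : CofreeCoalgebra k I →ₗ[k] k :=
  LinearMap.proj w ∘ₗ (cofreeSubmodule k I).subtype

theorem eq_zero_of_eval {f : CofreeCoalgebra k I} (h : ∀ w, eval w f = 0) : f = 0 :=
  Subtype.ext (funext h)

theorem ext_eval {f g : CofreeCoalgebra k I} (h : ∀ w, eval w f = eval w g) : f = g :=
  Subtype.ext (funext h)

theorem tensor_ext {s t : CofreeCoalgebra k I ⊗[k] CofreeCoalgebra k I}
    (h : ∀ u v, LinearMap.mul' k k (TensorProduct.map (eval u) (eval v) s) =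
      LinearMap.mul' k k (TensorProduct.map (eval u) (eval v) t)) : s = t :=
  sub_eq_zero.1 (TensorProduct.eq_zero_of_separating (fun _ => eq_zero_of_eval)
    (fun _ => eq_zero_of_eval) fun u v => by rw [map_sub, map_sub, h, sub_self])

theorem exists_comul (f : CofreeCoalgebra k I) :
    ∃ t : CofreeCoalgebra k I ⊗[k] CofreeCoalgebra k I, ∀ u v,
      LinearMap.mul' k k (TensorProduct.map (eval u) (eval v) t) = eval (u * v) f :=
  (isAdmissible_cofreeSubmodule k I f.1 f.2).2

/-- The comultiplication sends `f` to the tensor representing `(u, v) ↦ f (u v)`, which is unique by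
`tensor_ext`; the counit is evaluation at the empty word. -/
noncomputable instance : CoalgebraStruct k (CofreeCoalgebra k I) where
  comul :=
    { toFun f := (exists_comul f).choose
      map_add' f g := tensor_ext fun u v => by
        rw [(exists_comul (f + g)).choose_spec, map_add, map_add, map_add,
          (exists_comul f).choose_spec, (exists_comul g).choose_spec]
      map_smul' c f := tensor_ext fun u v => by
        rw [(exists_comul (c • f)).choose_spec, map_smul, map_smul, map_smul,
          (exists_comul f).choose_spec, RingHom.id_apply] }
  counit := eval 1

theorem counit_eq : (counit : CofreeCoalgebra k I →ₗ[k] k) = eval 1 := rfl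

/-- The comultiplication is deconcatenation: it is characterised by
`∑ f₁(u) f₂(v) = f(u v)`. -/
theorem mul'_map_eval_comul (f : CofreeCoalgebra k I) (u v : FreeMonoid I) :
    LinearMap.mul' k k (TensorProduct.map (eval u) (eval v) (comul (R := k) f)) =
      eval (u * v) f :=
  (exists_comul f).choose_spec u v

noncomputable instance : Coalgebra k (CofreeCoalgebra k I) where
  coassoc := by
    let C := CofreeCoalgebra k I
    let ev (u v : FreeMonoid I) : C ⊗[k] C →ₗ[k] k :=
      LinearMap.mul' k k ∘ₗ TensorProduct.map (eval u) (eval v)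
    have hev : ∀ u v, ev u v ∘ₗ comul = eval (u * v) := fun u v =>
      LinearMap.ext fun f => mul'_map_eval_comul f u v
    ext f
    refine sub_eq_zero.1 (TensorProduct.eq_zero_of_separating (e := eval)
      (e' := fun p : FreeMonoid I × FreeMonoid I => ev p.1 p.2) (fun _ => eq_zero_of_eval)
      (fun y hy => TensorProduct.eq_zero_of_separating (fun _ => eq_zero_of_eval)
        (fun _ => eq_zero_of_eval) fun i j => hy (i, j)) ?_)
    rintro u ⟨v, w⟩
    have h1 : ∀ s : (C ⊗[k] C) ⊗[k] C, LinearMap.mul' k k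
        (TensorProduct.map (eval u) (ev v w) (TensorProduct.assoc k C C C s)) =
        LinearMap.mul' k k (TensorProduct.map (ev u v) (eval w) s) := by
      intro s
      induction s with
      | zero => simp
      | add x y hx hy => simp only [map_add, hx, hy]
      | tmul x z =>
        induction x with
        | zero => simp
        | add x y hx hy => simp only [TensorProduct.add_tmul, map_add, hx, hy]
        | tmul x y => simp [ev, mul_assoc]
    rw [map_sub, map_sub, sub_eq_zero, LinearMap.comp_apply, LinearEquiv.coe_coe, h1,
      LinearMap.comp_apply, LinearMap.comp_apply, ← LinearMap.comp_apply (TensorProduct.map _ _),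
      ← LinearMap.comp_apply (TensorProduct.map _ _), LinearMap.map_comp_rTensor,
      LinearMap.map_comp_lTensor, hev, hev, mul'_map_eval_comul, mul'_map_eval_comul, mul_assoc]
  rTensor_counit_comp_comul := by
    ext f
    apply (TensorProduct.lid k _).injective
    refine ext_eval fun w => ?_
    have h : ∀ s : CofreeCoalgebra k I ⊗[k] CofreeCoalgebra k I,
        eval w (TensorProduct.lid k _ (LinearMap.rTensor _ (eval 1) s)) =
        LinearMap.mul' k k (TensorProduct.map (eval 1) (eval w) s) := by
      intro s
      induction s with
      | zero => simp
      | add x y hx hy => simp only [map_add, hx, hy]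
      | tmul x y => simp
    rw [LinearMap.comp_apply, counit_eq, h, mul'_map_eval_comul]
    simp
  lTensor_counit_comp_comul := by
    ext f
    apply (TensorProduct.rid k _).injective
    refine ext_eval fun w => ?_
    have h : ∀ s : CofreeCoalgebra k I ⊗[k] CofreeCoalgebra k I,
        eval w (TensorProduct.rid k _ (LinearMap.lTensor _ (eval 1) s)) =
        LinearMap.mul' k k (TensorProduct.map (eval w) (eval 1) s) := by
      intro s
      induction s with
      | zero => simp
      | add x y hx hy => simp only [map_add, hx, hy]
      | tmul x y => simp [mul_comm]
    rw [LinearMap.comp_apply, counit_eq, h, mul'_map_eval_comul]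
    simp

/-- The universal linear map: the values of a function on the letters. -/
noncomputable def proj : CofreeCoalgebra k I →ₗ[k] I →₀ k where
  toFun f := Finsupp.ofSupportFinite (fun i => eval (FreeMonoid.of i) f)
    (isAdmissible_cofreeSubmodule k I f.1 f.2).1
  map_add' f g := by ext i; exact map_add (eval (FreeMonoid.of i)) f g
  map_smul' c f := by ext i; exact map_smul (eval (FreeMonoid.of i)) c f

variable {N : Type*} [AddCommGroup N] [Module k N] [Coalgebra k N]

/-- Coalgebra maps to the cofree coalgebra are determined by their composites with `proj`: for such
a map `g`, `w ↦ eval w ∘ g` is a monoid map from words to the convolution algebra of `N`. -/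
theorem hom_ext {g g' : N →ₗc[k] CofreeCoalgebra k I} (h : ∀ n, proj (g n) = proj (g' n)) :
    g = g' := by
  let F (g : N →ₗc[k] CofreeCoalgebra k I) : FreeMonoid I →* WithConv (N →ₗ[k] k) :=
    { toFun w := toConv (eval w ∘ₗ (g : N →ₗ[k] CofreeCoalgebra k I))
      map_one' := by
        ext n
        exact CoalgHomClass.counit_comp_apply g n
      map_mul' u v := by
        ext n
        refine (mul'_map_eval_comul (g n) u v).symm.trans ?_
        rw [← CoalgHomClass.map_comp_comul_apply, LinearMap.convMul_apply, TensorProduct.map_map] }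
  have hF : F g = F g' := FreeMonoid.hom_eq fun i =>
    WithConv.ext (LinearMap.ext fun n => DFunLike.congr_fun (h n) i)
  ext n
  exact ext_eval fun w => LinearMap.congr_fun (congrArg ofConv (DFunLike.congr_fun hF w)) n

/-- The words, as functionals on `N`: a word goes to the convolution product of the coordinates of
`φ` at its letters. -/
noncomputable def wordFunctional (φ : N →ₗ[k] I →₀ k) : FreeMonoid I →* WithConv (N →ₗ[k] k) :=
  FreeMonoid.lift fun i => toConv (Finsupp.lapply i ∘ₗ φ)

/-- The function on words defined by an element of `N`. -/
noncomputable def liftFun (φ : N →ₗ[k] I →₀ k) : N →ₗ[k] FreeMonoid I → k :=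
  LinearMap.pi fun w => (wordFunctional φ w).ofConv

theorem map_liftFun_comul (φ : N →ₗ[k] I →₀ k) (n : N) (u v : FreeMonoid I) :
    LinearMap.mul' k k (TensorProduct.map (LinearMap.proj u ∘ₗ liftFun φ)
      (LinearMap.proj v ∘ₗ liftFun φ) (comul (R := k) n)) = liftFun φ n (u * v) := by
  change _ = wordFunctional φ (u * v) n
  rw [map_mul]
  rfl

theorem isAdmissible_range_liftFun (φ : N →ₗ[k] I →₀ k) :
    IsAdmissible (LinearMap.range (liftFun φ)) := by
  rintro _ ⟨n, rfl⟩
  refine ⟨(φ n).hasFiniteSupport.subset fun i hi => ?_,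
    TensorProduct.map (liftFun φ).rangeRestrict (liftFun φ).rangeRestrict (comul n),
    fun u v => ?_⟩
  · simpa [liftFun, wordFunctional] using hi
  · rw [← map_liftFun_comul, evalPair, LinearMap.comp_apply, TensorProduct.map_map]
    rfl

/-- The linear map underlying `CofreeCoalgebra.lift`. -/
noncomputable def liftLinearMap (φ : N →ₗ[k] I →₀ k) : N →ₗ[k] CofreeCoalgebra k I :=
  (liftFun φ).codRestrict (cofreeSubmodule k I) fun n =>
    le_sSup (a := LinearMap.range (liftFun φ)) (isAdmissible_range_liftFun φ)
      (LinearMap.mem_range_self _ n)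

theorem eval_liftLinearMap (φ : N →ₗ[k] I →₀ k) (w : FreeMonoid I) :
    eval w ∘ₗ liftLinearMap φ = LinearMap.proj w ∘ₗ liftFun φ := rfl

/-- The coalgebra map to the cofree coalgebra induced by a linear map. -/
noncomputable def lift (φ : N →ₗ[k] I →₀ k) : N →ₗc[k] CofreeCoalgebra k I where
  toLinearMap := liftLinearMap φ
  counit_comp := by
    ext n
    change wordFunctional φ 1 n = _
    rw [map_one]
    simp
  map_comp_comul := by
    ext n
    refine tensor_ext fun u v => ?_
    rw [LinearMap.comp_apply, LinearMap.comp_apply, mul'_map_eval_comul, TensorProduct.map_map,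
      eval_liftLinearMap, eval_liftLinearMap, map_liftFun_comul]
    rfl

@[simp]
theorem proj_lift (φ : N →ₗ[k] I →₀ k) (n : N) : proj (lift φ n) = φ n := by
  ext i
  change wordFunctional φ (FreeMonoid.of i) n = _
  simp [wordFunctional]

-- From here on only `hom_ext` and `proj_lift` are used; unfolding these makes unification expensive.
attribute [irreducible] proj lift

end Coalgebra

end CofreeCoalgebra

/-! ### The bialgebra structure on the cofree coalgebra -/

namespace CofreeCoalgebra

section Bialgebra

variable {k : Type u} {I : Type v} [Field k]

/-- The linear map `N ⊗ P → V`, `n ⊗ p ↦ ε(n) ψ(p) + ε(p) φ(n)`. -/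
noncomputable def counitSum {N P V : Type*} [AddCommGroup N] [Module k N] [Coalgebra k N]
    [AddCommGroup P] [Module k P] [Coalgebra k P] [AddCommGroup V] [Module k V]
    (φ : N →ₗ[k] V) (ψ : P →ₗ[k] V) : N ⊗[k] P →ₗ[k] V :=
  (TensorProduct.lid k V).toLinearMap ∘ₗ TensorProduct.map counit ψ +
    (TensorProduct.rid k V).toLinearMap ∘ₗ TensorProduct.map φ counit

@[simp]
theorem counitSum_tmul {N P V : Type*} [AddCommGroup N] [Module k N] [Coalgebra k N]
    [AddCommGroup P] [Module k P] [Coalgebra k P] [AddCommGroup V] [Module k V]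
    (φ : N →ₗ[k] V) (ψ : P →ₗ[k] V) (n : N) (p : P) :
    counitSum φ ψ (n ⊗ₜ p) = counit (R := k) n • ψ p + counit (R := k) p • φ n := by
  simp [counitSum]

/-- The multiplication of the cofree coalgebra: the coalgebra map that makes `proj` a derivation
along the counit. -/
@[irreducible]
noncomputable def mulHom :
    CofreeCoalgebra k I ⊗[k] CofreeCoalgebra k I →ₗc[k] CofreeCoalgebra k I :=
  lift (counitSum proj proj)

/-- The unit of the cofree coalgebra: the coalgebra map `k → C` that `proj` sends to zero. -/
@[irreducible]
noncomputable def unitHom : k →ₗc[k] CofreeCoalgebra k I := lift 0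

noncomputable instance : Mul (CofreeCoalgebra k I) := ⟨fun a b => mulHom (a ⊗ₜ b)⟩

noncomputable instance : One (CofreeCoalgebra k I) := ⟨unitHom (1 : k)⟩

theorem mul_def (a b : CofreeCoalgebra k I) : a * b = mulHom (a ⊗ₜ b) := rfl

theorem one_def : (1 : CofreeCoalgebra k I) = unitHom (1 : k) := rfl

theorem proj_mul (a b : CofreeCoalgebra k I) :
    proj (a * b) = counit (R := k) a • proj b + counit (R := k) b • proj a := by
  rw [mul_def, mulHom, proj_lift, counitSum_tmul]

theorem proj_one : proj (1 : CofreeCoalgebra k I) = 0 := by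
  rw [one_def, unitHom, proj_lift, LinearMap.zero_apply]

theorem counit_mul' (a b : CofreeCoalgebra k I) :
    counit (R := k) (a * b) = counit (R := k) a * counit (R := k) b := by
  rw [mul_def, CoalgHomClass.counit_comp_apply, TensorProduct.counit_tmul, smul_eq_mul, mul_comm]

theorem counit_one' : counit (R := k) (1 : CofreeCoalgebra k I) = 1 := by
  rw [one_def, CoalgHomClass.counit_comp_apply]
  rfl

/-! The unit and associativity laws equate two coalgebra maps to the cofree coalgebra, so `hom_ext`
reduces them to identities between their composites with `proj`. -/

theorem one_mul' (a : CofreeCoalgebra k I) : 1 * a = a := by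
  have h : (mulHom.comp ((Coalgebra.TensorProduct.map unitHom (CoalgHom.id k _)).comp
      (Coalgebra.TensorProduct.lid k (CofreeCoalgebra k I)).symm.toCoalgHom)) =
      CoalgHom.id k (CofreeCoalgebra k I) := hom_ext fun n => by
    change proj (1 * n) = proj n
    rw [proj_mul, proj_one, counit_one', one_smul, smul_zero, add_zero]
  exact DFunLike.congr_fun h a

theorem mul_one' (a : CofreeCoalgebra k I) : a * 1 = a := by
  have h : (mulHom.comp ((Coalgebra.TensorProduct.map (CoalgHom.id k _) unitHom).comp
      (Coalgebra.TensorProduct.rid k k (CofreeCoalgebra k I)).symm.toCoalgHom)) =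
      CoalgHom.id k (CofreeCoalgebra k I) := hom_ext fun n => by
    change proj (n * 1) = proj n
    rw [proj_mul, proj_one, counit_one', one_smul, smul_zero, zero_add]
  exact DFunLike.congr_fun h a

theorem mul_assoc' (a b c : CofreeCoalgebra k I) : a * b * c = a * (b * c) := by
  have h : mulHom.comp (Coalgebra.TensorProduct.map mulHom
        (CoalgHom.id k (CofreeCoalgebra k I))) =
      mulHom.comp ((Coalgebra.TensorProduct.map (CoalgHom.id k (CofreeCoalgebra k I)) mulHom).comp
        (Coalgebra.TensorProduct.assoc k k (CofreeCoalgebra k I) (CofreeCoalgebra k I)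
          (CofreeCoalgebra k I)).toCoalgHom) := hom_ext fun n => by
    induction n with
    | zero => simp only [map_zero]
    | add x y hx hy => simp only [map_add, hx, hy]
    | tmul x c =>
      induction x with
      | zero => simp only [TensorProduct.zero_tmul, map_zero]
      | add x y hx hy => simp only [TensorProduct.add_tmul, map_add, hx, hy]
      | tmul a b =>
        change proj (a * b * c) = proj (a * (b * c))
        simp only [proj_mul, counit_mul', smul_add, smul_smul, mul_comm, add_assoc]
  exact DFunLike.congr_fun h ((a ⊗ₜ b) ⊗ₜ c)

noncomputable instance : Ring (CofreeCoalgebra k I) where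
  __ := instAddCommGroup
  left_distrib a b c := by simp only [mul_def, TensorProduct.tmul_add, map_add]
  right_distrib a b c := by simp only [mul_def, TensorProduct.add_tmul, map_add]
  zero_mul a := by simp only [mul_def, TensorProduct.zero_tmul, map_zero]
  mul_zero a := by simp only [mul_def, TensorProduct.tmul_zero, map_zero]
  mul_assoc := mul_assoc'
  one_mul := one_mul'
  mul_one := mul_one'

noncomputable instance : Algebra k (CofreeCoalgebra k I) :=
  Algebra.ofModule
    (fun c a b => by simp only [mul_def, ← TensorProduct.smul_tmul', map_smul])
    (fun c a b => by simp only [mul_def, TensorProduct.tmul_smul, map_smul])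

noncomputable instance : Bialgebra k (CofreeCoalgebra k I) :=
  Bialgebra.mk' k (CofreeCoalgebra k I) counit_one' (fun {a b} => counit_mul' a b)
    (by
      rw [one_def, ← CoalgHomClass.map_comp_comul_apply]
      rfl)
    (fun {a b} => by
      have h : ((mulHom : _ →ₗc[k] CofreeCoalgebra k I) : _ →ₗ[k] CofreeCoalgebra k I) =
          LinearMap.mul' k (CofreeCoalgebra k I) := TensorProduct.ext' fun a b => rfl
      rw [mul_def, ← CoalgHomClass.map_comp_comul_apply, TensorProduct.comul_tmul,
        ← LinearMap.mul'_apply (R := k), LinearMap.mul'_tensor, LinearMap.comp_apply, ← h]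
      rfl)

/-- If `φ` is a derivation along the counit, the coalgebra map it induces to the cofree coalgebra is
multiplicative: `n ⊗ m ↦ g(n m)` and `n ⊗ m ↦ g(n) g(m)` are coalgebra maps with the same composite
with `proj`. -/
theorem exists_bialgHom {N : Type*} [Ring N] [Bialgebra k N] {φ : N →ₗ[k] I →₀ k}
    (h : IsCounitDerivation φ) :
    ∃ g : N →ₐc[k] CofreeCoalgebra k I, ∀ n, proj (g n) = φ n := by
  have h1 : (lift φ).comp (unitBialgHom k N : k →ₗc[k] N) = unitHom := hom_ext fun c => by
    rw [unitHom, proj_lift]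
    change proj (lift φ (algebraMap k N c)) = _
    rw [proj_lift, Algebra.algebraMap_eq_smul_one, map_smul, h.map_one, smul_zero,
      LinearMap.zero_apply]
  have h2 : (lift φ).comp (mulCoalgHom k N) =
      mulHom.comp (Coalgebra.TensorProduct.map (lift φ) (lift φ)) := hom_ext fun x => by
    induction x with
    | zero => simp only [map_zero]
    | add x y hx hy => simp only [map_add, hx, hy]
    | tmul n m =>
      change proj (lift φ (n * m)) = proj (lift φ n * lift φ m)
      rw [proj_mul, proj_lift, proj_lift, proj_lift, h, CoalgHomClass.counit_comp_apply,
        CoalgHomClass.counit_comp_apply]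
  refine ⟨{ lift φ with
    map_one' := ?_
    map_mul' := fun n m => DFunLike.congr_fun h2 (n ⊗ₜ m) }, proj_lift φ⟩
  refine Eq.trans ?_ (DFunLike.congr_fun h1 1)
  exact congrArg (lift φ) (_root_.map_one (algebraMap k N)).symm

end Bialgebra

end CofreeCoalgebra

/-! ### The universal bimeasuring bialgebra of a commutative algebra -/

/-- A bimeasuring `N ⊗ k[x] → A` is the same as a derivation `N → A` along the counit, and these are
represented by the cofree coalgebra on the vector space `A`. -/
theorem isUniversalBimeasuring_cofreeCoalgebra {k : Type u} [Field k] {A : Type v} [CommRing A]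
    [Algebra k A] {I : Type v} (b : Module.Basis I k A) :
    IsUniversalBimeasuring
      (polynomialMeasuring (b.repr.symm.toLinearMap ∘ₗ CofreeCoalgebra.proj (k := k) (I := I))) where
  isBimeasuring := IsCounitDerivation.isBimeasuring fun n m => by
    simp only [LinearMap.comp_apply, CofreeCoalgebra.proj_mul, map_add, map_smul]
  existsUnique_lift N _ _ f hf := by
    have hφ : IsCounitDerivation
        (b.repr.toLinearMap ∘ₗ (TensorProduct.curry f).flip Polynomial.X) := fun n m => by
      simp only [LinearMap.comp_apply, hf.isCounitDerivation n m, map_add, map_smul]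
    obtain ⟨g, hg⟩ := CofreeCoalgebra.exists_bialgHom hφ
    have hval : ∀ (g : N →ₐc[k] CofreeCoalgebra k I) (n : N),
        (polynomialMeasuring (b.repr.symm.toLinearMap ∘ₗ CofreeCoalgebra.proj) ∘ₗ
          LinearMap.rTensor k[X] (g : N →ₗ[k] CofreeCoalgebra k I)) (n ⊗ₜ Polynomial.X) =
        b.repr.symm (CofreeCoalgebra.proj (g n)) := fun g n => by
      rw [LinearMap.comp_apply, LinearMap.rTensor_tmul, polynomialMeasuring_tmul_X]
      rfl
    refine ⟨g, ?_, fun g' hg' => ?_⟩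
    · have hm := (isMeasuring_polynomialMeasuring
        (b.repr.symm.toLinearMap ∘ₗ CofreeCoalgebra.proj)).comp_rTensor
        (g : N →ₗc[k] CofreeCoalgebra k I)
      refine hf.left.polynomial_ext hm fun n => ?_
      refine Eq.trans ?_ (hval g n).symm
      rw [hg, LinearMap.comp_apply, LinearEquiv.coe_coe, LinearEquiv.symm_apply_apply]
      rfl
    · refine BialgHom.coe_coalgHom_injective (CofreeCoalgebra.hom_ext fun n => ?_)
      have h := (LinearMap.congr_fun hg' (n ⊗ₜ Polynomial.X)).trans (hval g' n)
      exact ((LinearEquiv.symm_apply_eq b.repr).1 h.symm).trans (hg n).symm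

theorem mainTheorem9 (k : Type u) [Field k] (A : Type v) [Ring A] [Algebra k A] :
    (HasUniversalBimeasuring.{u, v, max u v} k k[X] A ↔ ∀ a b : A, a * b = b * a) ∧
    (∀ α : A, ∃ ψ : k[X] ⊗[k] k[X] →ₗ[k] A, IsBimeasuring ψ ∧
      ∀ i j : ℕ, ψ ((Polynomial.X ^ i) ⊗ₜ[k] (Polynomial.X ^ j)) =
        if i = j then (Nat.factorial i : A) * α ^ i else 0) := by
  refine ⟨⟨fun h => HasUniversalBimeasuring.mul_comm.{u, v, v} h, fun h => ?_⟩, fun α => ?_⟩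
  · let _ : CommRing A := { ‹Ring A› with mul_comm := h }
    exact ⟨_, _, _, _,
      isUniversalBimeasuring_cofreeCoalgebra (Module.Basis.ofVectorSpace k A)⟩
  · obtain ⟨ψ, hψ, hX⟩ := IsBimeasuring.exists_of_isCounitDerivation
      (PolynomialHopf.isCounitDerivation_lcoeff k) α
    exact ⟨ψ, hψ, hψ.left.apply_X_pow_tmul_X_pow hX⟩
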